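/- Let $d\ge 1$, $K\ge 3$ and $\Lambda=(\mathbb Z/K\mathbb Z)^d\cong\{1,\dots,K\}^d$. For a potential $V=\{v_n\}_{n\in\Lambda}$ let $H=-\Delta+V$ act on $\mathbb R^\Lambda$ by $$(H\varphi)_n=-\sum_{|m-n|_1=1}(\varphi_m-\varphi_n)+v_n\varphi_n=-\sum_{i=1}^d\big(\varphi_{n+e_i}+\varphi_{n-e_i}-2\varphi_n\big)+v_n\varphi_n ,\qquad n\in\Lambda .$$ Let $$N(\mu)=K^{-d}\,\#\{\text{eigenvalues }\lambda\text{ of }H\text{, counted with multiplicity, such that }\lambda\le\mu\}.$$ If $V$ is non-negative and not identically zero, there is a unique $u=\{u_n\}_{n\in\Lambda}$ with $(Hu)_n=1$ for all $n\in\Lambda$ (the landscape function), and $u_n>0$ for all $n$. For a positive integer $s$ write $K=qs+r$ with $0\le r<s$; let $\mathcal P_1(s)$ be the partition of $\{1,\dots,K\}$ into the $q$ blocks $\{js+1,\dots,(j+1)s\}$, $0\le j<q$, and, if $r>0$, the additional block $\{qs+1,\dots,K\}$; let $\mathcal P(s)$ be the partition of $\Lambda$ into the Cartesian products of $d$ members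 of $\mathcal P_1(s)$. For $\mu>0$ let $$N_u(\mu)=K^{-d}\,\#\Big\{Q\in\mathcal P\big(\lceil\mu^{-1/2}\rceil\big):\ \min_{n\in Q}\frac1{u_n}\le\mu\Big\}.$$ **Statement.** For every $d\ge1$ there are constants $C_1,c_3>0$, depending only on $d$, such that for every real number $V_{\max}$ and every $\vec p=(p_1,\dots,p_d)\in\mathbb N^d$ there is a constant $c_2>0$, depending only on $d$, $V_{\max}$ and $\vec p$, with the following property. Let $K\ge3$ be divisible by each $p_i$, and let $V=\{v_n\}_{n\in\Lambda}$ be a real-valued, non-negative, non-constant potential with $\max_{n\in\Lambda}v_n=V_{\max}$ which is periodic with period vector $\vec p$, i.e. $v_{n+p_ie_i}=v_n$ for all $n\in\Lambda$ and $1\le i\le d$. Then $$c_3\,N_u(c_2\mu)\ \le\ N(\mu)\ \le\ N_u(C_1\mu)\qquad\text{for all }\mu>0 .$$ -/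

import Mathlib

namespace LandscapeLaw

/-- The integer torus `Λ = (ℤ/Kℤ)^d`. -/
abbrev Torus (d K : ℕ) : Type := Fin d → ZMod K

/-- The unit vector `e_i` of the torus. -/
def e {d K : ℕ} (i : Fin d) : Torus d K := Pi.single i 1

/-- The tight-binding Hamiltonian `H = -Δ + V` with periodic boundary conditions,
`(H φ)_n = -∑_{|m - n|₁ = 1} (φ_m - φ_n) + v_n φ_n`; the nearest neighbours of `n` are
`n + e_i` and `n - e_i`, `i = 1, …, d` (they are `2d` distinct points when `K ≥ 3`). -/
def hamiltonian {d K : ℕ} (V : Torus d K → ℝ) :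
    (Torus d K → ℝ) →ₗ[ℝ] (Torus d K → ℝ) where
  toFun φ n := -(∑ i, ((φ (n + e i) - φ n) + (φ (n - e i) - φ n))) + V n * φ n
  map_add' φ ψ := by
    funext n
    have h : (∑ i, (((φ + ψ) (n + e i) - (φ + ψ) n) + ((φ + ψ) (n - e i) - (φ + ψ) n)))
        = (∑ i, ((φ (n + e i) - φ n) + (φ (n - e i) - φ n)))
          + ∑ i, ((ψ (n + e i) - ψ n) + (ψ (n - e i) - ψ n)) := by
      rw [← Finset.sum_add_distrib]
      exact Finset.sum_congr rfl fun i _ => by simp only [Pi.add_apply]; ring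
    simp only [Pi.add_apply] at h ⊢
    rw [h]
    ring
  map_smul' c φ := by
    funext n
    have h : (∑ i, (((c • φ) (n + e i) - (c • φ) n) + ((c • φ) (n - e i) - (c • φ) n)))
        = c * ∑ i, ((φ (n + e i) - φ n) + (φ (n - e i) - φ n)) := by
      rw [Finset.mul_sum]
      exact Finset.sum_congr rfl fun i _ => by simp only [Pi.smul_apply, smul_eq_mul]; ring
    simp only [Pi.smul_apply, smul_eq_mul, RingHom.id_apply] at h ⊢
    rw [h]
    ring

/-- The normalized integrated density of states `N(μ)`: the number of eigenvalues `λ ≤ μ` of `H`,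
counted with multiplicity (as roots of the characteristic polynomial), divided by `K^d`. -/
noncomputable def ids {d K : ℕ} [NeZero K] (V : Torus d K → ℝ) (μ : ℝ) : ℝ :=
  (Multiset.card ((hamiltonian V).charpoly.roots.filter (fun l => l ≤ μ)) : ℝ) / (K : ℝ) ^ d

/-- The landscape function: the solution `u` of `(H u)_n = 1`, `n ∈ Λ`. It exists, is unique and
is positive when `V` is non-negative and not identically zero, see
`existsUnique_landscape`, `hamiltonian_landscape` and `landscape_pos`. -/
noncomputable def landscape {d K : ℕ} (V : Torus d K → ℝ) : Torus d K → ℝ :=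
  Classical.epsilon fun u => ∀ n, hamiltonian V u n = 1

/-- The representative in `{1, …, K}` of a congruence class modulo `K`. -/
def rep {K : ℕ} (x : ZMod K) : ℕ := (x - 1).val + 1

/-- The `j`-th block `{j s + 1, …, (j + 1) s} ∩ {1, …, K}`. -/
def block (K : ℕ) [NeZero K] (s j : ℕ) : Finset (ZMod K) :=
  Finset.univ.filter fun x => j * s < rep x ∧ rep x ≤ (j + 1) * s

/-- The partition `𝒫₁(s)` of `{1, …, K}`: with `K = q s + r`, `0 ≤ r < s`, it consists of `q` blocks
of `s` consecutive elements and, if `r > 0`, of one further block with `r` elements. -/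
def partition₁ (K : ℕ) [NeZero K] (s : ℕ) : Finset (Finset (ZMod K)) :=
  (Finset.range (K / s + if 0 < K % s then 1 else 0)).image (block K s)

/-- The partition `𝒫(s)` of the torus into the products of `d` members of `𝒫₁(s)`. -/
def partition (d K : ℕ) [NeZero K] (s : ℕ) : Finset (Finset (Torus d K)) :=
  (Fintype.piFinset fun _ : Fin d => partition₁ K s).image fun I => Fintype.piFinset I

/-- The box side length `s(μ) = ⌈μ^{-1/2}⌉`. -/
noncomputable def side (μ : ℝ) : ℕ := ⌈μ ^ (-(1 / 2) : ℝ)⌉₊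

open Classical in
/-- The landscape box counting function `N_u(μ)`: the number of boxes `Q ∈ 𝒫(s(μ))` on which the
minimum of `1 / u_n` does not exceed `μ`, divided by `K^d`. -/
noncomputable def boxCount {d K : ℕ} [NeZero K] (u : Torus d K → ℝ) (μ : ℝ) : ℝ :=
  (((partition d K (side μ)).filter fun Q => ∃ n ∈ Q, 1 / u n ≤ μ).card : ℝ) / (K : ℝ) ^ d

/-- `V` is periodic in each coordinate direction, with period vector `p`. -/
def IsPeriodic {d K : ℕ} (V : Torus d K → ℝ) (p : Fin d → ℕ) : Prop :=
  ∀ (i : Fin d) (n : Torus d K), V (n + p i • e i) = V n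

theorem hamiltonian_apply {d K : ℕ} (V φ : Torus d K → ℝ) (n : Torus d K) :
    hamiltonian V φ n =
      -(∑ i, ((φ (n + e i) - φ n) + (φ (n - e i) - φ n))) + V n * φ n := rfl

/-- Every set of points of the torus that is closed under the shifts by `e_i` and is non-empty is
the whole torus. -/
theorem torus_induction {d K : ℕ} [NeZero K] (P : Torus d K → Prop)
    (h : ∀ n i, P n → P (n + e i)) (n : Torus d K) (hn : P n) (m : Torus d K) : P m := by
  have h1 : ∀ (k : ℕ) (i : Fin d) (n : Torus d K), P n → P (n + k • e i) := by
    intro k i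
    induction k with
    | zero => intro n hn; simpa using hn
    | succ k ih =>
      intro n hn
      rw [succ_nsmul, ← add_assoc]
      exact h _ _ (ih n hn)
  have h2 : ∀ s : Finset (Fin d), P (n + ∑ i ∈ s, ((m - n) i).val • e i) := by
    intro s
    induction s using Finset.induction_on with
    | empty => simpa using hn
    | insert a s ha ih =>
      rw [Finset.sum_insert ha, add_comm (_ • _), ← add_assoc]
      exact h1 _ _ _ ih
  have h3 : n + ∑ i, ((m - n) i).val • e i = m := by
    funext j
    have h4 : (((m - n) j).val : ZMod K) = (m - n) j := ZMod.natCast_zmod_val _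
    have h5 : (∑ i, ((m - n) i).val • (e i : Torus d K)) j = (((m - n) j).val : ZMod K) := by
      rw [Finset.sum_apply, Finset.sum_eq_single j]
      · rw [Pi.smul_apply, e, Pi.single_eq_same, nsmul_one]
      · intro i _ hi
        rw [Pi.smul_apply, e, Pi.single_eq_of_ne' hi, smul_zero]
      · intro hj
        exact absurd (Finset.mem_univ j) hj
    rw [Pi.add_apply, h5, h4, Pi.sub_apply, add_sub_cancel]
  rw [← h3]
  exact h2 _

/-- Minimum principle. -/
theorem nonneg_of_hamiltonian_nonneg {d K : ℕ} [NeZero K] {V : Torus d K → ℝ}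
    (hV : ∀ n, 0 ≤ V n) (hV' : ∃ n, V n ≠ 0) {φ : Torus d K → ℝ}
    (h : ∀ n, 0 ≤ hamiltonian V φ n) (n : Torus d K) : 0 ≤ φ n := by
  obtain ⟨a, ha⟩ := Finite.exists_min φ
  by_contra hn
  have hneg : φ a < 0 := lt_of_le_of_lt (ha n) (not_le.mp hn)
  have key : ∀ m, φ m = φ a →
      (∑ i, ((φ (m + e i) - φ m) + (φ (m - e i) - φ m))) = 0 ∧ V m * φ m = 0 := by
    intro m hm
    have h1 : 0 ≤ ∑ i, ((φ (m + e i) - φ m) + (φ (m - e i) - φ m)) :=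
      Finset.sum_nonneg fun i _ => by
        have := ha (m + e i); have := ha (m - e i); linarith
    have h2 : V m * φ m ≤ 0 := mul_nonpos_of_nonneg_of_nonpos (hV m) (by linarith)
    have h3 := h m
    rw [hamiltonian_apply] at h3
    constructor <;> linarith
  have hall : ∀ m, φ m = φ a := by
    refine torus_induction (fun m => φ m = φ a) ?_ a rfl
    intro m i hm
    have h1 := (Finset.sum_eq_zero_iff_of_nonneg (fun i _ => by
        have := ha (m + e i); have := ha (m - e i); linarith)).mp (key m hm).1 i (Finset.mem_univ i)
    have := ha (m + e i); have := ha (m - e i)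
    show φ (m + e i) = φ a
    linarith
  obtain ⟨b, hb⟩ := hV'
  rcases mul_eq_zero.mp (key b (hall b)).2 with h1 | h1
  · exact hb h1
  · rw [hall b] at h1; linarith

theorem existsUnique_landscape {d K : ℕ} [NeZero K] {V : Torus d K → ℝ}
    (hV : ∀ n, 0 ≤ V n) (hV' : ∃ n, V n ≠ 0) :
    ∃! u : Torus d K → ℝ, ∀ n, hamiltonian V u n = 1 := by
  have hinj : Function.Injective (hamiltonian V) := by
    rw [injective_iff_map_eq_zero]
    intro φ hφ
    funext n
    have h1 := nonneg_of_hamiltonian_nonneg hV hV' (φ := φ) (fun n => by rw [hφ]; simp) n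
    have h2 := nonneg_of_hamiltonian_nonneg hV hV' (φ := -φ)
      (fun n => by rw [map_neg, hφ]; simp) n
    simp only [Pi.neg_apply, Pi.zero_apply] at h2 ⊢
    linarith
  obtain ⟨u, hu⟩ := LinearMap.injective_iff_surjective.mp hinj (fun _ => 1)
  exact ⟨u, fun n => by rw [hu], fun w hw => hinj (by rw [hu]; exact funext hw)⟩

theorem hamiltonian_landscape {d K : ℕ} [NeZero K] {V : Torus d K → ℝ}
    (hV : ∀ n, 0 ≤ V n) (hV' : ∃ n, V n ≠ 0) (n : Torus d K) :
    hamiltonian V (landscape V) n = 1 :=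
  Classical.epsilon_spec (p := fun u : Torus d K → ℝ => ∀ n, hamiltonian V u n = 1)
    (existsUnique_landscape hV hV').exists n

theorem landscape_pos {d K : ℕ} [NeZero K] {V : Torus d K → ℝ}
    (hV : ∀ n, 0 ≤ V n) (hV' : ∃ n, V n ≠ 0) (n : Torus d K) : 0 < landscape V n := by
  have h1 := hamiltonian_landscape hV hV'
  have h2 := nonneg_of_hamiltonian_nonneg hV hV' (φ := landscape V) (fun n => by rw [h1]; simp)
  refine lt_of_le_of_ne (h2 n) fun h0 => ?_
  have h3 := h1 n
  rw [hamiltonian_apply, ← h0] at h3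
  have : 0 ≤ ∑ i, ((landscape V (n + e i) - 0) + (landscape V (n - e i) - 0)) :=
    Finset.sum_nonneg fun i _ => by
      have := h2 (n + e i); have := h2 (n - e i); linarith
  linarith

end LandscapeLaw

/-! Upper bound: testing `H u = 1` against `φ² / u` shows that the form of `H` dominates both the
gradient energy and `∑ φ² / u`. At level `μ' = (2^d + 2) μ`, impose mean zero on every counted box.
There the Poincaré inequality on side `⌈μ'^(-1/2)⌉` gives `μ' ∑ φ² ≤ 2^d · energy`; on the other
boxes `1 / u > μ'`. Hence `μ' ∑ φ² ≤ (2^d + 1) · form`, so the form exceeds `μ ∑ φ²`, and min-max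
(`card_roots_le_of_constraints`) bounds the eigenvalue count by the number of constraints, one per
counted box.

Lower bound: periodicity puts a point with `V = Vmax` within one period cell of the maximum of `u`,
and a Harnack-type chain bounds `u` by some `M` independent of `K` (`landscape_le_of_periodic`). If
`μ ≥ 4d + Vmax`, the whole spectrum lies below `μ` and `N(μ) = 1`; otherwise `c₂ μ M < 1` and no box
is counted. So `c₃ = 1` suffices. -/

namespace LandscapeLaw

/-! ### Eigenvalue counting by min-max. -/

section Spectral

variable {ι : Type*} [Fintype ι]

/-- A symmetric operator on `ℝ^ι` has an orthonormal eigenbasis, whose eigenvalues are the roots of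
its characteristic polynomial. -/
theorem exists_orthonormal_eigenbasis (T : (ι → ℝ) →ₗ[ℝ] (ι → ℝ))
    (hT : ∀ f g : ι → ℝ, ∑ n, g n * T f n = ∑ n, f n * T g n) :
    ∃ (v : ι → ι → ℝ) (l : ι → ℝ), (∀ i, T (v i) = l i • v i) ∧
      (∀ i, ∑ n, v i n * v i n = 1) ∧ (∀ i j, i ≠ j → ∑ n, v i n * v j n = 0) ∧
      T.charpoly.roots = Multiset.map l Finset.univ.val := by
  classical
  set A := LinearMap.toMatrix' T with hAdef
  have hA : A.IsHermitian := by
    ext i j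
    have h := hT (Pi.single i 1) (Pi.single j 1)
    simp only [Pi.single_apply, ite_mul, one_mul, zero_mul, Finset.sum_ite_eq',
      Finset.mem_univ, if_true] at h
    rw [Matrix.conjTranspose_apply, star_trivial, hAdef, LinearMap.toMatrix'_apply,
      LinearMap.toMatrix'_apply]
    exact h
  have horth : ∀ i j, ∑ n, hA.eigenvectorBasis i n * hA.eigenvectorBasis j n
      = if i = j then 1 else 0 := by
    intro i j
    have h := orthonormal_iff_ite.mp hA.eigenvectorBasis.orthonormal i j
    rw [← h, PiLp.inner_apply]
    exact Finset.sum_congr rfl fun n _ => by simp [mul_comm]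
  refine ⟨fun i => (hA.eigenvectorBasis i).ofLp, hA.eigenvalues, fun i => ?_, fun i => ?_,
    fun i j hij => ?_, ?_⟩
  · exact (LinearMap.toMatrix'_mulVec T _).symm.trans (hA.mulVec_eigenvectorBasis i)
  · rw [horth, if_pos rfl]
  · rw [horth, if_neg hij]
  · have h : A.charpoly = T.charpoly := by
      rw [← Matrix.charpoly_toLin', hAdef, Matrix.toLin'_toMatrix']
    rw [← h]
    exact hA.roots_charpoly_eq_eigenvalues

theorem card_filter_map_univ (l : ι → ℝ) (μ : ℝ) :
    Multiset.card ((Multiset.map l Finset.univ.val).filter fun x => x ≤ μ)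
      = (Finset.univ.filter fun i => l i ≤ μ).card := by
  rw [Multiset.filter_map, Multiset.card_map]
  rfl

/-- If the quadratic form of a symmetric operator exceeds `μ` on the non-zero vectors that satisfy
finitely many linear constraints, then there are at most as many eigenvalues `≤ μ` as there are
constraints. -/
theorem card_roots_le_of_constraints (T : (ι → ℝ) →ₗ[ℝ] (ι → ℝ))
    (hT : ∀ f g : ι → ℝ, ∑ n, g n * T f n = ∑ n, f n * T g n)
    {κ : Type*} (F : Finset κ) (ℓ : κ → (ι → ℝ) →ₗ[ℝ] ℝ) (μ : ℝ)
    (h : ∀ φ : ι → ℝ, φ ≠ 0 → (∀ k ∈ F, ℓ k φ = 0) →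
      μ * ∑ n, φ n ^ 2 < ∑ n, φ n * T φ n) :
    Multiset.card (T.charpoly.roots.filter fun x => x ≤ μ) ≤ F.card := by
  classical
  obtain ⟨v, l, hv, hv1, hv0, hroots⟩ := exists_orthonormal_eigenbasis T hT
  rw [hroots, card_filter_map_univ]
  by_contra! hlt
  set S := Finset.univ.filter fun i => l i ≤ μ with hS
  let L : (S → ℝ) →ₗ[ℝ] (ι → ℝ) := Fintype.linearCombination ℝ fun i : S => v i
  have hL : ∀ c, L c = ∑ i, c i • v i := fun c => Fintype.linearCombination_apply ..
  have hortho : ∀ i j : S, ∑ n, v i n * v j n = if i = j then 1 else 0 := by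
    intro i j
    split_ifs with hij
    · rw [hij, hv1]
    · exact hv0 _ _ fun h => hij (Subtype.ext h)
  have hpair : ∀ a b : S → ℝ,
      ∑ n, (∑ i, a i • v i) n * (∑ i, b i • v i) n = ∑ i, a i * b i := by
    intro a b
    have : ∀ n, (∑ i, a i • v i) n * (∑ i, b i • v i) n
        = ∑ i, ∑ j, a i * b j * (v i n * v j n) := by
      intro n
      rw [Finset.sum_apply, Finset.sum_apply, Finset.sum_mul_sum]
      refine Finset.sum_congr rfl fun i _ => Finset.sum_congr rfl fun j _ => ?_
      simp only [Pi.smul_apply, smul_eq_mul]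
      ring
    simp_rw [this]
    rw [Finset.sum_comm]
    refine Finset.sum_congr rfl fun i _ => ?_
    rw [Finset.sum_comm]
    simp_rw [← Finset.mul_sum, hortho]
    simp
  let G : (S → ℝ) →ₗ[ℝ] (F → ℝ) := LinearMap.pi fun k => (ℓ k).comp L
  -- More eigenvectors than constraints: some non-zero combination satisfies them all, yet its form
  -- is at most `μ` times its squared norm.
  have hker : LinearMap.ker G ≠ ⊥ := by
    apply LinearMap.ker_ne_bot_of_finrank_lt
    simpa using hlt
  obtain ⟨c, hc, hc0⟩ := (Submodule.ne_bot_iff _).mp hker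
  have hcon : ∀ k ∈ F, ℓ k (L c) = 0 := fun k hk => by
    have := congrFun (LinearMap.mem_ker.mp hc) ⟨k, hk⟩
    exact this
  have hsq : ∑ n, L c n ^ 2 = ∑ i, c i ^ 2 := by
    have := hpair c c
    rw [hL]
    simpa only [pow_two] using this
  have hTL : T (L c) = ∑ i : S, (c i * l i) • v i := by
    rw [hL, map_sum]
    refine Finset.sum_congr rfl fun i _ => ?_
    rw [map_smul, hv, smul_smul]
  have hform : ∑ n, L c n * T (L c) n = ∑ i : S, c i * (c i * l i) := by
    rw [hTL, hL]
    exact hpair c fun i => c i * l i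
  have hne : L c ≠ 0 := by
    intro h0
    rw [h0] at hsq
    apply hc0
    funext i
    have hz : ∑ i, c i ^ 2 = 0 := by rw [← hsq]; simp
    exact pow_eq_zero_iff two_ne_zero |>.mp
      ((Finset.sum_eq_zero_iff_of_nonneg fun i _ => sq_nonneg (c i)).mp hz i (Finset.mem_univ i))
  have := h (L c) hne hcon
  rw [hsq, hform, Finset.mul_sum] at this
  refine absurd this (not_lt.mpr (Finset.sum_le_sum fun i _ => ?_))
  have hi : l i ≤ μ := (Finset.mem_filter.mp i.2).2
  nlinarith [sq_nonneg (c i)]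

/-- If the quadratic form of a symmetric operator is at most `μ`, all eigenvalues are `≤ μ`. -/
theorem card_roots_eq_of_form_le (T : (ι → ℝ) →ₗ[ℝ] (ι → ℝ))
    (hT : ∀ f g : ι → ℝ, ∑ n, g n * T f n = ∑ n, f n * T g n) (μ : ℝ)
    (h : ∀ φ : ι → ℝ, ∑ n, φ n * T φ n ≤ μ * ∑ n, φ n ^ 2) :
    Multiset.card (T.charpoly.roots.filter fun x => x ≤ μ) = Fintype.card ι := by
  obtain ⟨v, l, hv, hv1, -, hroots⟩ := exists_orthonormal_eigenbasis T hT
  rw [hroots, card_filter_map_univ, Finset.filter_true_of_mem, Finset.card_univ]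
  intro i _
  have h1 := h (v i)
  have h2 := hv1 i
  simp only [hv, Pi.smul_apply, smul_eq_mul, mul_left_comm _ (l i), ← Finset.mul_sum, pow_two,
    h2] at h1
  linarith

end Spectral

/-! ### The quadratic form of `H` and the uncertainty principle. -/

section Energy

variable {d K : ℕ}

/-- The square of the discrete derivative in direction `i`. -/
def edgeEnergy (φ : Torus d K → ℝ) (i : Fin d) (n : Torus d K) : ℝ := (φ (n + e i) - φ n) ^ 2

theorem edgeEnergy_nonneg (φ : Torus d K → ℝ) (i : Fin d) (n : Torus d K) :
    0 ≤ edgeEnergy φ i n := sq_nonneg _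

variable [NeZero K]

theorem sum_shift (f : Torus d K → ℝ) (a : Torus d K) : ∑ n, f (n + a) = ∑ n, f n :=
  Equiv.sum_comp (Equiv.addRight a) f

/-- Summation by parts. -/
theorem sum_mul_hamiltonian (V f g : Torus d K → ℝ) :
    ∑ n, g n * hamiltonian V f n =
      (∑ n, ∑ i, (f (n + e i) - f n) * (g (n + e i) - g n)) + ∑ n, V n * f n * g n := by
  have h1 : ∀ i : Fin d, ∑ n, g n * ((f (n + e i) - f n) + (f (n - e i) - f n))
      = -∑ n, (f (n + e i) - f n) * (g (n + e i) - g n) := by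
    intro i
    have h2 : ∑ n, g n * (f (n - e i) - f n) = ∑ n, g (n + e i) * (f n - f (n + e i)) := by
      rw [← sum_shift (fun n => g n * (f (n - e i) - f n)) (e i)]
      simp only [add_sub_cancel_right]
    simp only [mul_add, Finset.sum_add_distrib]
    rw [h2, ← Finset.sum_add_distrib, ← Finset.sum_neg_distrib]
    exact Finset.sum_congr rfl fun n _ => by ring
  have h3 : ∀ n, g n * hamiltonian V f n
      = -(∑ i, g n * ((f (n + e i) - f n) + (f (n - e i) - f n))) + V n * f n * g n := by
    intro n
    rw [hamiltonian_apply, ← Finset.mul_sum]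
    ring
  simp_rw [h3]
  rw [Finset.sum_add_distrib, Finset.sum_neg_distrib, Finset.sum_comm]
  simp_rw [h1]
  rw [Finset.sum_neg_distrib, neg_neg, Finset.sum_comm]

theorem hamiltonian_symmetric (V f g : Torus d K → ℝ) :
    ∑ n, g n * hamiltonian V f n = ∑ n, f n * hamiltonian V g n := by
  rw [sum_mul_hamiltonian, sum_mul_hamiltonian]
  congr 1
  · exact Finset.sum_congr rfl fun n _ => Finset.sum_congr rfl fun i _ => mul_comm _ _
  · exact Finset.sum_congr rfl fun n _ => by ring

theorem hamiltonian_form (V φ : Torus d K → ℝ) :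
    ∑ n, φ n * hamiltonian V φ n = (∑ n, ∑ i, edgeEnergy φ i n) + ∑ n, V n * φ n ^ 2 := by
  rw [sum_mul_hamiltonian]
  congr 1
  · exact Finset.sum_congr rfl fun n _ => Finset.sum_congr rfl fun i _ => (pow_two _).symm
  · exact Finset.sum_congr rfl fun n _ => by ring

theorem sum_edgeEnergy_le_form {V : Torus d K → ℝ} (hV : ∀ n, 0 ≤ V n) (φ : Torus d K → ℝ) :
    ∑ n, ∑ i, edgeEnergy φ i n ≤ ∑ n, φ n * hamiltonian V φ n := by
  rw [hamiltonian_form]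
  exact le_add_of_nonneg_right (Finset.sum_nonneg fun n _ => mul_nonneg (hV n) (sq_nonneg _))

/-- Each direction contributes at most `4 ∑ φ²`, by `(a - b)² ≤ 2a² + 2b²` and shift invariance. -/
theorem form_le {V : Torus d K → ℝ} {M : ℝ} (hV : ∀ n, V n ≤ M) (φ : Torus d K → ℝ) :
    ∑ n, φ n * hamiltonian V φ n ≤ (4 * d + M) * ∑ n, φ n ^ 2 := by
  rw [hamiltonian_form]
  have h1 : ∑ n, ∑ i, edgeEnergy φ i n ≤ 4 * d * ∑ n, φ n ^ 2 := by
    have h2 : ∀ i : Fin d, ∑ n, edgeEnergy φ i n ≤ 4 * ∑ n, φ n ^ 2 := by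
      intro i
      have h3 := sum_shift (fun n => φ n ^ 2) (e i : Torus d K)
      calc ∑ n, edgeEnergy φ i n ≤ ∑ n, (2 * φ (n + e i) ^ 2 + 2 * φ n ^ 2) :=
            Finset.sum_le_sum fun n _ => by
              unfold edgeEnergy
              nlinarith [sq_nonneg (φ (n + e i) + φ n)]
        _ = 4 * ∑ n, φ n ^ 2 := by
            rw [Finset.sum_add_distrib, ← Finset.mul_sum, ← Finset.mul_sum, h3]
            ring
    rw [Finset.sum_comm]
    refine (Finset.sum_le_sum fun i _ => h2 i).trans_eq ?_
    rw [Finset.sum_const, Finset.card_univ, Fintype.card_fin, nsmul_eq_mul]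
    ring
  have h4 : ∑ n, V n * φ n ^ 2 ≤ M * ∑ n, φ n ^ 2 := by
    rw [Finset.mul_sum]
    exact Finset.sum_le_sum fun n _ => mul_le_mul_of_nonneg_right (hV n) (sq_nonneg _)
  linarith

/-- The landscape uncertainty principle: `1 / u` acts as an effective potential. -/
theorem sum_sq_div_landscape_le_form {V u : Torus d K → ℝ} (hu : ∀ n, 0 < u n)
    (hHu : ∀ n, hamiltonian V u n = 1) (φ : Torus d K → ℝ) :
    ∑ n, φ n ^ 2 / u n ≤ ∑ n, φ n * hamiltonian V φ n := by
  -- Test `H u = 1` against `φ² / u`. After summation by parts the potential terms agree exactly, so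
  -- only an edgewise inequality remains.
  have h1 : ∑ n, φ n ^ 2 / u n = ∑ n, φ n ^ 2 / u n * hamiltonian V u n :=
    Finset.sum_congr rfl fun n _ => by rw [hHu, mul_one]
  rw [h1, sum_mul_hamiltonian, hamiltonian_form]
  have edge : ∀ a b x y : ℝ, 0 < x → 0 < y →
      (x - y) * (a ^ 2 / x - b ^ 2 / y) ≤ (a - b) ^ 2 := by
    intro a b x y hx hy
    have : (a - b) ^ 2 - (x - y) * (a ^ 2 / x - b ^ 2 / y) = (y * a - x * b) ^ 2 / (x * y) := by
      field_simp
      ring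
    have h2 : 0 ≤ (y * a - x * b) ^ 2 / (x * y) := by positivity
    linarith
  refine add_le_add (Finset.sum_le_sum fun n _ => Finset.sum_le_sum fun i _ =>
    edge _ _ _ _ (hu _) (hu _)) (Finset.sum_le_sum fun n _ => ?_)
  have := (hu n).ne'
  exact le_of_eq (by field_simp)

end Energy

/-! ### Uniform bound on the landscape of a periodic potential. -/

section UpperBound

variable {d K : ℕ}

/-- Going up in one step costs at most a factor `2 d + 1`. -/
theorem deficit_step {u : Torus d K → ℝ} {V : Torus d K → ℝ} (hV : ∀ n, 0 ≤ V n)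
    (hu : ∀ n, 0 < u n) (hHu : ∀ n, hamiltonian V u n = 1) {M : ℝ} (hM : ∀ n, u n ≤ M)
    (n : Torus d K) (i : Fin d) :
    M - u (n + e i) + 1 ≤ (2 * d + 1) * (M - u n + 1) := by
  have h1 := hHu n
  rw [hamiltonian_apply] at h1
  -- Every `u - M` is non-positive, so a single neighbour's deficit is controlled by the sum over
  -- all neighbours, which the equation at `n` controls. The `+ 1` in the deficit absorbs the source
  -- term.
  have h2 : (u (n + e i) - M) + (u (n - e i) - M) ≥
      ∑ j, ((u (n + e j) - M) + (u (n - e j) - M)) := by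
    rw [← Finset.add_sum_erase _ _ (Finset.mem_univ i)]
    have : ∑ j ∈ Finset.univ.erase i, ((u (n + e j) - M) + (u (n - e j) - M)) ≤ 0 :=
      Finset.sum_nonpos fun j _ => by
        have := hM (n + e j); have := hM (n - e j); linarith
    linarith
  have h3 : ∑ j : Fin d, ((u (n + e j) - M) + (u (n - e j) - M))
      = (∑ j, ((u (n + e j) - u n) + (u (n - e j) - u n))) - 2 * d * (M - u n) := by
    rw [eq_sub_iff_add_eq]
    have : 2 * (d : ℝ) * (M - u n) = ∑ _j : Fin d, 2 * (M - u n) := by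
      rw [Finset.sum_const, Finset.card_univ, Fintype.card_fin, nsmul_eq_mul]; ring
    rw [this, ← Finset.sum_add_distrib]
    exact Finset.sum_congr rfl fun j _ => by ring
  have h4 := hM (n - e i)
  have h5 := mul_nonneg (hV n) (hu n).le
  have h6 := hM n
  have hd : (1 : ℝ) ≤ d := by exact_mod_cast i.pos
  nlinarith

/-- Iterates `deficit_step` along a lattice path; started at a maximum of `u`, it keeps `u` close to
that maximum over a whole period cell. -/
theorem deficit_path {u : Torus d K → ℝ} {V : Torus d K → ℝ} (hV : ∀ n, 0 ≤ V n)
    (hu : ∀ n, 0 < u n) (hHu : ∀ n, hamiltonian V u n = 1) {M : ℝ} (hM : ∀ n, u n ≤ M)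
    (k : Fin d → ℕ) (n : Torus d K) (s : Finset (Fin d)) :
    M - u (n + ∑ i ∈ s, k i • e i) + 1 ≤ (2 * d + 1) ^ (∑ i ∈ s, k i) * (M - u n + 1) := by
  have hline : ∀ (i : Fin d) (m : ℕ) (n : Torus d K),
      M - u (n + m • e i) + 1 ≤ (2 * d + 1) ^ m * (M - u n + 1) := by
    intro i m n
    induction m with
    | zero => simp
    | succ m ih =>
      rw [succ_nsmul, ← add_assoc, pow_succ', mul_assoc]
      exact (deficit_step hV hu hHu hM _ i).trans (mul_le_mul_of_nonneg_left ih (by positivity))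
  induction s using Finset.induction_on with
  | empty => simp
  | insert a s ha ih =>
    rw [Finset.sum_insert ha, Finset.sum_insert ha, add_comm (_ • _), ← add_assoc, pow_add,
      mul_assoc]
    exact (hline _ _ _).trans (mul_le_mul_of_nonneg_left ih (by positivity))

theorem IsPeriodic.add_sum {V : Torus d K → ℝ} {p : Fin d → ℕ} (h : IsPeriodic V p)
    (q : Fin d → ℕ) (n : Torus d K) (s : Finset (Fin d)) :
    V (n + ∑ i ∈ s, (p i * q i) • e i) = V n := by
  have hline : ∀ (i : Fin d) (m : ℕ) (n : Torus d K), V (n + (p i * m) • e i) = V n := by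
    intro i m n
    induction m with
    | zero => simp
    | succ m ih => rw [mul_add, mul_one, add_smul, ← add_assoc, h, ih]
  induction s using Finset.induction_on with
  | empty => simp
  | insert a s ha ih => rw [Finset.sum_insert ha, add_comm (_ • _), ← add_assoc, hline, ih]

/-- A periodic potential takes each of its values in every period cell. -/
theorem IsPeriodic.exists_in_cell [NeZero K] {V : Torus d K → ℝ} {p : Fin d → ℕ} (h : IsPeriodic V p)
    (hp : ∀ i, p i ∣ K) (n m : Torus d K) :
    ∃ k : Fin d → ℕ, (∀ i, k i ≤ p i) ∧ V (n + ∑ i, k i • e i) = V m := by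
  -- Reduce `m - n` modulo the periods; the quotients are undone by periodicity.
  refine ⟨fun i => ((m - n) i).val % p i, fun i => (Nat.mod_lt _ ?_).le, ?_⟩
  · exact Nat.pos_of_dvd_of_pos (hp i) (Nat.pos_of_ne_zero (NeZero.ne K))
  · rw [← h.add_sum (fun i => ((m - n) i).val / p i) _ Finset.univ, add_assoc,
      ← Finset.sum_add_distrib]
    simp_rw [← add_smul, Nat.mod_add_div]
    congr 1
    funext j
    have h5 : (∑ i, ((m - n) i).val • (e i : Torus d K)) j = (((m - n) j).val : ZMod K) := by
      rw [Finset.sum_apply, Finset.sum_eq_single j]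
      · rw [Pi.smul_apply, e, Pi.single_eq_same, nsmul_one]
      · intro i _ hi
        rw [Pi.smul_apply, e, Pi.single_eq_of_ne' hi, smul_zero]
      · intro hj
        exact absurd (Finset.mem_univ j) hj
    rw [Pi.add_apply, h5, ZMod.natCast_zmod_val, Pi.sub_apply, add_sub_cancel]

/-- The landscape function of a periodic potential is bounded in terms of the dimension, the
maximum of the potential and the periods. -/
theorem landscape_le_of_periodic [NeZero K] {u : Torus d K → ℝ} {V : Torus d K → ℝ} (hV : ∀ n, 0 ≤ V n)
    (hu : ∀ n, 0 < u n) (hHu : ∀ n, hamiltonian V u n = 1) {p : Fin d → ℕ}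
    (hper : IsPeriodic V p) (hp : ∀ i, p i ∣ K) {v : ℝ} (hv : 0 < v) (hmem : v ∈ Set.range V)
    (n : Torus d K) :
    u n ≤ (1 + 2 * d * (2 * d + 1) ^ (∑ i, p i)) / v + (2 * d + 1) ^ (∑ i, p i) := by
  obtain ⟨a, ha⟩ := Finite.exists_max u
  refine (ha n).trans ?_
  obtain ⟨b, rfl⟩ := hmem
  obtain ⟨k, hk, hVk⟩ := hper.exists_in_cell hp a b
  set m := a + ∑ i, k i • e i with hm
  have h1 := deficit_path hV hu hHu ha k a Finset.univ
  rw [← hm, sub_self, zero_add, mul_one] at h1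
  have h2 : ((2 * d + 1 : ℝ)) ^ (∑ i, k i) ≤ (2 * d + 1) ^ (∑ i, p i) :=
    pow_le_pow_right₀ (by have := Nat.cast_nonneg (α := ℝ) d; linarith)
      (Finset.sum_le_sum fun i _ => hk i)
  set W : ℝ := (2 * d + 1) ^ (∑ i, p i)
  have h3 := hHu m
  rw [hamiltonian_apply, hVk] at h3
  -- At `m` the potential is `V b > 0`, so the equation bounds `u m` once this sum is bounded.
  have h4 : ∑ i, ((u (m + e i) - u m) + (u (m - e i) - u m)) ≤ 2 * d * (u a - u m) := by
    refine (Finset.sum_le_sum (g := fun _ => 2 * (u a - u m)) fun i _ => ?_).trans_eq ?_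
    · have := ha (m + e i); have := ha (m - e i); linarith
    · rw [Finset.sum_const, Finset.card_univ, Fintype.card_fin, nsmul_eq_mul]; ring
  have h5 : u a - u m ≤ W := by linarith
  have h6 : 2 * (d : ℝ) * (u a - u m) ≤ 2 * d * W := mul_le_mul_of_nonneg_left h5 (by positivity)
  have h7 : u m ≤ (1 + 2 * d * W) / V b := by
    rw [le_div_iff₀ hv]
    linarith
  linarith

end UpperBound


/-! ### Poincaré inequality on products, by tensorization. -/

section Poincare

/-- Exchanging the coordinates in `T` between two points of a box. -/
theorem sum_sum_piecewise_swap {ι α : Type*} [Fintype ι] [DecidableEq ι] (I : ι → Finset α)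
    (T : Finset ι) (g : (ι → α) → (ι → α) → ℝ) :
    ∑ x ∈ Fintype.piFinset I, ∑ y ∈ Fintype.piFinset I, g (T.piecewise y x) (T.piecewise x y)
      = ∑ x ∈ Fintype.piFinset I, ∑ y ∈ Fintype.piFinset I, g x y := by
  classical
  rw [← Finset.sum_product', ← Finset.sum_product']
  have hmem : ∀ a ∈ Fintype.piFinset I ×ˢ Fintype.piFinset I,
      (T.piecewise a.2 a.1, T.piecewise a.1 a.2) ∈ Fintype.piFinset I ×ˢ Fintype.piFinset I := by
    intro a ha
    simp only [Finset.mem_product, Fintype.mem_piFinset] at ha ⊢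
    refine ⟨fun i => ?_, fun i => ?_⟩ <;> by_cases hi : i ∈ T <;> simp [hi, ha.1 i, ha.2 i]
  have hinv : ∀ a : (ι → α) × (ι → α),
      (T.piecewise (T.piecewise a.1 a.2) (T.piecewise a.2 a.1),
        T.piecewise (T.piecewise a.2 a.1) (T.piecewise a.1 a.2)) = a := by
    intro a
    ext i <;> by_cases hi : i ∈ T <;> simp [hi]
  exact Finset.sum_nbij' (fun a => (T.piecewise a.2 a.1, T.piecewise a.1 a.2))
    (fun a => (T.piecewise a.2 a.1, T.piecewise a.1 a.2)) hmem hmem (fun a _ => hinv a)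
    (fun a _ => hinv a) (fun a _ => rfl)

/-- Resampling one coordinate of a point of a box. -/
theorem sum_sum_update {ι α : Type*} [Fintype ι] [DecidableEq ι] (I : ι → Finset α) (k : ι)
    (g : (ι → α) → ℝ) :
    ∑ x ∈ Fintype.piFinset I, ∑ a ∈ I k, g (Function.update x k a)
      = (I k).card * ∑ x ∈ Fintype.piFinset I, g x := by
  have h : ∑ x ∈ Fintype.piFinset I, ∑ a ∈ I k, g (Function.update x k a)
      = ∑ x ∈ Fintype.piFinset I, ∑ _a ∈ I k, g x := by
    rw [← Finset.sum_product', ← Finset.sum_product']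
    have hmem : ∀ b ∈ Fintype.piFinset I ×ˢ I k,
        (Function.update b.1 k b.2, b.1 k) ∈ Fintype.piFinset I ×ˢ I k := by
      intro b hb
      simp only [Finset.mem_product, Fintype.mem_piFinset] at hb ⊢
      refine ⟨fun i => ?_, hb.1 k⟩
      by_cases hi : i = k
      · subst hi; simpa using hb.2
      · simpa [hi] using hb.1 i
    have hinv : ∀ b : (ι → α) × α, (Function.update (Function.update b.1 k b.2) k (b.1 k),
        Function.update b.1 k b.2 k) = b := by
      intro b
      simp
    exact Finset.sum_nbij' (fun b => (Function.update b.1 k b.2, b.1 k))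
      (fun b => (Function.update b.1 k b.2, b.1 k)) hmem hmem (fun b _ => hinv b)
      (fun b _ => hinv b) (fun b _ => rfl)
  rw [h]
  simp only [Finset.sum_const, nsmul_eq_mul, Finset.mul_sum]

/-- Tensorization of a one-dimensional oscillation bound over the coordinates in `T`. -/
theorem sum_sum_piecewise_sub_sq_le {ι α : Type*} [Fintype ι] [DecidableEq ι]
    (I : ι → Finset α) (φ : (ι → α) → ℝ) (E : ι → (ι → α) → ℝ) (hE : ∀ k x, 0 ≤ E k x)
    {c s : ℝ} (hc : 0 ≤ c) (hs : ∀ k, ((I k).card : ℝ) ≤ s)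
    (h : ∀ k, ∀ x ∈ Fintype.piFinset I, ∀ b ∈ I k,
      (φ (Function.update x k b) - φ x) ^ 2 ≤ c * ∑ a ∈ I k, E k (Function.update x k a))
    (T : Finset ι) :
    ∑ x ∈ Fintype.piFinset I, ∑ y ∈ Fintype.piFinset I, (φ (T.piecewise y x) - φ x) ^ 2
      ≤ 2 ^ T.card * ((Fintype.piFinset I).card * (c * s)
        * ∑ k ∈ T, ∑ x ∈ Fintype.piFinset I, E k x) := by
  induction T using Finset.induction_on with
  | empty => simp
  | insert k T hk ih =>
    set Q := Fintype.piFinset I with hQ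
    have hEk : 0 ≤ ∑ x ∈ Q, E k x := Finset.sum_nonneg fun x _ => hE k x
    have step : ∑ x ∈ Q, ∑ y ∈ Q, (φ ((insert k T).piecewise y x) - φ (T.piecewise y x)) ^ 2
        ≤ Q.card * (c * s) * ∑ x ∈ Q, E k x := by
      have h1 : ∑ x ∈ Q, ∑ y ∈ Q, (φ ((insert k T).piecewise y x) - φ (T.piecewise y x)) ^ 2
          = ∑ x ∈ Q, ∑ y ∈ Q, (φ (Function.update x k (y k)) - φ x) ^ 2 := by
        -- Swapping the coordinates in `T` turns the resampled point into a plain summation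
        -- variable; since `k ∉ T`, the new value `y k` is untouched.
        rw [hQ, ← sum_sum_piecewise_swap I T
          fun x y => (φ (Function.update x k (y k)) - φ x) ^ 2]
        refine Finset.sum_congr rfl fun x _ => Finset.sum_congr rfl fun y _ => ?_
        rw [Finset.piecewise_insert, Finset.piecewise_eq_of_notMem _ _ _ hk]
      rw [h1]
      calc ∑ x ∈ Q, ∑ y ∈ Q, (φ (Function.update x k (y k)) - φ x) ^ 2
          ≤ ∑ x ∈ Q, ∑ _y ∈ Q, c * ∑ a ∈ I k, E k (Function.update x k a) :=
            Finset.sum_le_sum fun x hx => Finset.sum_le_sum fun y hy =>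
              h k x hx _ (Fintype.mem_piFinset.mp hy k)
        _ = Q.card * (c * ((I k).card * ∑ x ∈ Q, E k x)) := by
            simp only [Finset.sum_const, nsmul_eq_mul]
            rw [← Finset.mul_sum, ← Finset.mul_sum, hQ, sum_sum_update]
        _ ≤ Q.card * (c * (s * ∑ x ∈ Q, E k x)) := by
            have := hs k
            gcongr
        _ = _ := by ring
    have h2 : ∑ x ∈ Q, ∑ y ∈ Q, (φ ((insert k T).piecewise y x) - φ x) ^ 2
        ≤ 2 * (∑ x ∈ Q, ∑ y ∈ Q, (φ ((insert k T).piecewise y x) - φ (T.piecewise y x)) ^ 2)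
          + 2 * ∑ x ∈ Q, ∑ y ∈ Q, (φ (T.piecewise y x) - φ x) ^ 2 := by
      rw [Finset.mul_sum, Finset.mul_sum, ← Finset.sum_add_distrib]
      refine Finset.sum_le_sum fun x _ => ?_
      rw [Finset.mul_sum, Finset.mul_sum, ← Finset.sum_add_distrib]
      refine Finset.sum_le_sum fun y _ => ?_
      -- This is `(a + b)² ≤ 2a² + 2b²` for successive increments; the doubling produces `2 ^
      -- T.card`.
      nlinarith [sq_nonneg (φ ((insert k T).piecewise y x) - 2 * φ (T.piecewise y x) + φ x)]
    rcases Q.eq_empty_or_nonempty with hQ0 | ⟨x₀, hx₀⟩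
    · simp [hQ0]
    have hs0 : 0 ≤ s := (Nat.cast_nonneg _).trans (hs k)
    rw [Finset.card_insert_of_notMem hk, Finset.sum_insert hk, pow_succ]
    have h3 : (1 : ℝ) ≤ 2 ^ T.card := one_le_pow₀ one_le_two
    have h4 : 0 ≤ Q.card * (c * s) * ∑ x ∈ Q, E k x := by positivity
    nlinarith [mul_nonneg (sub_nonneg.mpr h3) h4]

/-- The Poincaré inequality on a box, for functions of mean zero. -/
theorem sum_sq_le_of_sum_eq_zero {ι α : Type*} [Fintype ι] [DecidableEq ι]
    (I : ι → Finset α) (φ : (ι → α) → ℝ) (E : ι → (ι → α) → ℝ) (hE : ∀ k x, 0 ≤ E k x)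
    {c s : ℝ} (hc : 0 ≤ c) (hs : ∀ k, ((I k).card : ℝ) ≤ s)
    (h : ∀ k, ∀ x ∈ Fintype.piFinset I, ∀ b ∈ I k,
      (φ (Function.update x k b) - φ x) ^ 2 ≤ c * ∑ a ∈ I k, E k (Function.update x k a))
    (h0 : ∑ x ∈ Fintype.piFinset I, φ x = 0) :
    2 * ∑ x ∈ Fintype.piFinset I, φ x ^ 2
      ≤ 2 ^ Fintype.card ι * (c * s) * ∑ x ∈ Fintype.piFinset I, ∑ k, E k x := by
  have h1 := sum_sum_piecewise_sub_sq_le I φ E hE hc hs h Finset.univ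
  simp only [Finset.piecewise_univ, Finset.card_univ] at h1
  set Q := Fintype.piFinset I
  -- Mean zero kills the cross term.
  have h2 : ∑ x ∈ Q, ∑ y ∈ Q, (φ y - φ x) ^ 2 = Q.card * (2 * ∑ x ∈ Q, φ x ^ 2) := by
    have : ∀ x, ∑ y ∈ Q, (φ y - φ x) ^ 2 = (∑ y ∈ Q, φ y ^ 2) + Q.card * φ x ^ 2 := by
      intro x
      have h3 : ∀ y, (φ y - φ x) ^ 2 = φ y ^ 2 - 2 * φ x * φ y + φ x ^ 2 := fun y => by ring
      simp only [h3, Finset.sum_add_distrib, Finset.sum_sub_distrib, ← Finset.mul_sum, h0,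
        Finset.sum_const, nsmul_eq_mul, mul_zero, sub_zero]
    simp only [this, Finset.sum_add_distrib, ← Finset.mul_sum, Finset.sum_const, nsmul_eq_mul]
    ring
  rw [h2, Finset.sum_comm] at h1
  rcases Q.eq_empty_or_nonempty with hQ | hQ
  · simp [hQ]
  have hpos : (0 : ℝ) < Q.card := by exact_mod_cast hQ.card_pos
  refine le_of_mul_le_mul_left (h1.trans_eq ?_) hpos
  ring

end Poincare

/-! ### One-dimensional blocks. -/

section Blocks

variable {K : ℕ}

theorem rep_pos (x : ZMod K) : 1 ≤ rep x := Nat.le_add_left _ _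

theorem rep_natCast {n : ℕ} (h1 : 1 ≤ n) (h2 : n ≤ K) : rep (n : ZMod K) = n := by
  obtain ⟨m, rfl⟩ := Nat.exists_eq_add_of_le' h1
  rw [rep, Nat.cast_add, Nat.cast_one, add_sub_cancel_right, ZMod.val_cast_of_lt h2]

variable [NeZero K]

theorem rep_le (x : ZMod K) : rep x ≤ K := ZMod.val_lt (x - 1)

theorem natCast_rep (x : ZMod K) : (rep x : ZMod K) = x := by
  simp [rep]

theorem rep_injective : Function.Injective (rep : ZMod K → ℕ) := fun x y h => by
  rw [← natCast_rep x, ← natCast_rep y, h]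

theorem mem_block {s j : ℕ} {x : ZMod K} :
    x ∈ block K s j ↔ j * s < rep x ∧ rep x ≤ (j + 1) * s := by
  simp [block]

theorem card_block_le (s j : ℕ) : (block K s j).card ≤ s := by
  have h := Finset.card_le_card_of_injOn (s := block K s j) (t := Finset.Ioc (j * s) ((j + 1) * s))
    rep (fun x hx => by simpa using mem_block.mp hx) rep_injective.injOn
  rw [Nat.card_Ioc, add_mul, one_mul, Nat.add_sub_cancel_left] at h
  exact h

/-- The oscillation of a function on a block of length `s`. -/
theorem sub_sq_le_block {s j : ℕ} (f : ZMod K → ℝ) {x y : ZMod K} (hx : x ∈ block K s j)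
    (hy : y ∈ block K s j) :
    (f y - f x) ^ 2 ≤ (s - 1) * ∑ a ∈ block K s j, (f (a + 1) - f a) ^ 2 := by
  wlog hxy : rep x ≤ rep y generalizing x y
  · rw [← neg_sub, neg_sq]
    exact this hy hx (not_le.mp hxy).le
  rw [mem_block] at hx hy
  -- Telescope along representatives, which never wraps around modulo `K`; then Cauchy–Schwarz over
  -- at most `s - 1` edges.
  have h1 : f y - f x = ∑ n ∈ Finset.Ico (rep x) (rep y),
      (f ((n : ZMod K) + 1) - f (n : ZMod K)) := by
    have := Finset.sum_Ico_sub (fun n : ℕ => f (n : ZMod K)) hxy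
    rw [natCast_rep, natCast_rep] at this
    rw [← this]
    exact Finset.sum_congr rfl fun n _ => by rw [Nat.cast_add, Nat.cast_one]
  have hmem : ∀ n ∈ Finset.Ico (rep x) (rep y), rep (n : ZMod K) = n := fun n hn => by
    have hn := Finset.mem_Ico.mp hn
    exact rep_natCast ((rep_pos x).trans hn.1) (hn.2.le.trans (rep_le y))
  have h2 : ∑ n ∈ Finset.Ico (rep x) (rep y), (f ((n : ZMod K) + 1) - f (n : ZMod K)) ^ 2
      ≤ ∑ a ∈ block K s j, (f (a + 1) - f a) ^ 2 := by
    rw [← Finset.sum_image (s := Finset.Ico (rep x) (rep y)) (g := fun n : ℕ => (n : ZMod K))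
      (f := fun a => (f (a + 1) - f a) ^ 2)]
    · refine Finset.sum_le_sum_of_subset_of_nonneg ?_ fun _ _ _ => sq_nonneg _
      intro a ha
      obtain ⟨n, hn, rfl⟩ := Finset.mem_image.mp ha
      rw [mem_block, hmem n hn]
      have hn := Finset.mem_Ico.mp hn
      exact ⟨hx.1.trans_le hn.1, hn.2.le.trans hy.2⟩
    · intro n hn m hm hnm
      rw [← hmem n hn, ← hmem m hm]
      exact congrArg rep hnm
  have h3 : ((Finset.Ico (rep x) (rep y)).card : ℝ) ≤ s - 1 := by
    rw [Nat.card_Ico, le_sub_iff_add_le]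
    have : rep y - rep x + 1 ≤ s := by
      rw [add_mul, one_mul] at hy
      omega
    exact_mod_cast this
  rw [h1]
  refine sq_sum_le_card_mul_sum_sq.trans (mul_le_mul h3 h2 ?_ ?_)
  · exact Finset.sum_nonneg fun _ _ => sq_nonneg _
  · exact (Nat.cast_nonneg _).trans h3

theorem eq_of_mem_block {s j j' : ℕ} {x : ZMod K} (h : x ∈ block K s j) (h' : x ∈ block K s j') :
    j = j' := by
  rw [mem_block] at h h'
  have h1 : j < j' + 1 := lt_of_mul_lt_mul_right (h.1.trans_le h'.2) (Nat.zero_le s)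
  have h2 : j' < j + 1 := lt_of_mul_lt_mul_right (h'.1.trans_le h.2) (Nat.zero_le s)
  omega

theorem mem_partition₁ {s : ℕ} {B : Finset (ZMod K)} (h : B ∈ partition₁ K s) :
    ∃ j, B = block K s j := by
  obtain ⟨j, -, rfl⟩ := Finset.mem_image.mp h
  exact ⟨j, rfl⟩

theorem exists_mem_partition₁ {s : ℕ} (hs : 0 < s) (x : ZMod K) :
    ∃ B ∈ partition₁ K s, x ∈ B := by
  have h1 := rep_pos x
  have h2 := rep_le x
  have h3 := Nat.div_add_mod (rep x - 1) s
  have h4 := Nat.mod_lt (rep x - 1) hs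
  have h5 := Nat.div_add_mod K s
  refine ⟨block K s ((rep x - 1) / s), Finset.mem_image_of_mem _ (Finset.mem_range.mpr ?_),
    mem_block.mpr ⟨?_, ?_⟩⟩
  · split_ifs with hr
    · exact Nat.lt_succ_of_le (Nat.div_le_div_right (by omega))
    · rw [Nat.div_lt_iff_lt_mul hs, add_zero, mul_comm]
      omega
  · rw [mul_comm]; omega
  · rw [add_mul, one_mul, mul_comm]; omega

theorem card_partition₁_le {s : ℕ} (hs : 0 < s) : (partition₁ K s).card ≤ K := by
  refine Finset.card_image_le.trans ?_
  rw [Finset.card_range]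
  split_ifs with hr
  -- A remainder block forces `s ≥ 2`, hence `K / s < K`, leaving room for the extra block.
  · have : s ≠ 1 := by rintro rfl; simp [Nat.mod_one] at hr
    exact Nat.div_lt_self (Nat.pos_of_ne_zero (NeZero.ne K)) (by omega)
  · exact Nat.div_le_self K s

end Blocks

/-! ### Boxes of the torus. -/

section Partition

variable {d K : ℕ} [NeZero K]

theorem exists_of_mem_partition {s : ℕ} {Q : Finset (Torus d K)} (h : Q ∈ partition d K s) :
    ∃ j : Fin d → ℕ, Q = Fintype.piFinset fun i => block K s (j i) := by
  obtain ⟨I, hI, rfl⟩ := Finset.mem_image.mp h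
  choose j hj using fun i => mem_partition₁ (Fintype.mem_piFinset.mp hI i)
  exact ⟨j, by rw [← funext hj]⟩

theorem partition_pairwiseDisjoint (s : ℕ) :
    (partition d K s : Set (Finset (Torus d K))).PairwiseDisjoint id := by
  intro Q hQ Q' hQ' hne
  obtain ⟨j, rfl⟩ := exists_of_mem_partition hQ
  obtain ⟨j', rfl⟩ := exists_of_mem_partition hQ'
  refine Finset.disjoint_left.mpr fun x hx hx' => hne ?_
  have : j = j' := funext fun i =>
    eq_of_mem_block (Fintype.mem_piFinset.mp hx i) (Fintype.mem_piFinset.mp hx' i)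
  rw [this]

theorem sum_partition {s : ℕ} (hs : 0 < s) (f : Torus d K → ℝ) :
    ∑ Q ∈ partition d K s, ∑ n ∈ Q, f n = ∑ n, f n := by
  classical
  rw [← Finset.sum_biUnion (t := fun Q => Q) (partition_pairwiseDisjoint s)]
  congr 1
  refine Finset.eq_univ_iff_forall.mpr fun n => Finset.mem_biUnion.mpr ?_
  choose B hB hn using fun i => exists_mem_partition₁ hs (n i)
  exact ⟨Fintype.piFinset B, Finset.mem_image_of_mem _ (Fintype.mem_piFinset.mpr hB),
    Fintype.mem_piFinset.mpr hn⟩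

theorem card_partition_le {s : ℕ} (hs : 0 < s) : (partition d K s).card ≤ K ^ d := by
  refine Finset.card_image_le.trans ?_
  rw [Fintype.card_piFinset_const]
  exact Nat.pow_le_pow_left (card_partition₁_le hs) d

/-- The Poincaré inequality on the boxes of the partition. -/
theorem poincare_box {s : ℕ} (hs : 0 < s) {Q : Finset (Torus d K)} (hQ : Q ∈ partition d K s)
    (φ : Torus d K → ℝ) (h0 : ∑ n ∈ Q, φ n = 0) :
    2 * ∑ n ∈ Q, φ n ^ 2
      ≤ 2 ^ d * (((s : ℝ) - 1) * s) * ∑ n ∈ Q, ∑ i, edgeEnergy φ i n := by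
  obtain ⟨j, rfl⟩ := exists_of_mem_partition hQ
  have hs1 : (1 : ℝ) ≤ s := by exact_mod_cast hs
  have h := sum_sq_le_of_sum_eq_zero (s := (s : ℝ)) (fun i => block K s (j i)) φ (edgeEnergy φ)
    (edgeEnergy_nonneg φ) (sub_nonneg.mpr hs1)
    (fun k => Nat.cast_le.mpr (card_block_le s (j k))) (fun k x hx b hb => ?_) h0
  · rwa [Fintype.card_fin] at h
  -- Restrict `φ` to the line through `x` in direction `k`.
  · have h1 := sub_sq_le_block (fun a => φ (Function.update x k a))
      (Fintype.mem_piFinset.mp hx k) hb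
    rw [Function.update_eq_self] at h1
    refine h1.trans_eq ?_
    congr 1
    refine Finset.sum_congr rfl fun a _ => ?_
    have : Function.update x k a + e k = Function.update x k (a + 1) := by
      funext i
      by_cases hi : i = k
      · subst hi; simp [e]
      · simp [e, hi]
    rw [edgeEnergy, this]

end Partition


/-! ### The two bounds of the landscape law. -/

section Law

variable {d K : ℕ}

theorem side_pos {μ : ℝ} (hμ : 0 < μ) : 0 < side μ := Nat.ceil_pos.mpr (Real.rpow_pos_of_pos hμ _)

/-- Makes the Poincaré constant at scale `side μ` comparable to `1 / μ`. The factor `side μ - 1` is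
essential: for large `μ` the side is `1`, and `μ * side μ ^ 2` is unbounded. -/
theorem mul_side_le {μ : ℝ} (hμ : 0 < μ) : μ * (((side μ : ℝ) - 1) * side μ) ≤ 2 := by
  set t := μ ^ (-(1 / 2) : ℝ) with ht
  have ht0 : 0 < t := Real.rpow_pos_of_pos hμ _
  have htt : μ * (t * t) = 1 := by
    rw [ht, ← Real.rpow_add hμ, show (-(1 / 2) + -(1 / 2) : ℝ) = -1 by norm_num, Real.rpow_neg_one,
      mul_inv_cancel₀ hμ.ne']
  have h1 : (side μ : ℝ) < t + 1 := Nat.ceil_lt_add_one ht0.le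
  rcases le_or_gt t 1 with h | h
  · have h2 : side μ ≤ 1 := Nat.ceil_le.mpr (by exact_mod_cast h)
    have h3 : side μ = 1 := le_antisymm h2 (side_pos hμ)
    rw [h3]
    norm_num
  · have h2 : ((side μ : ℝ) - 1) * side μ ≤ 2 * (t * t) := by
      have : (0 : ℝ) ≤ side μ := Nat.cast_nonneg _
      nlinarith
    nlinarith

variable [NeZero K]

/-- On functions of mean zero on each box on which the effective potential `1 / u` is somewhere
at most `μ`, the quadratic form of `H` is at least `μ / (2 ^ d + 1)`. -/
theorem le_form_of_mean_zero {V u : Torus d K → ℝ} (hV : ∀ n, 0 ≤ V n) (hu : ∀ n, 0 < u n)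
    (hHu : ∀ n, hamiltonian V u n = 1) {μ : ℝ} (hμ : 0 < μ) (φ : Torus d K → ℝ)
    (h0 : ∀ Q ∈ partition d K (side μ), (∃ n ∈ Q, 1 / u n ≤ μ) → ∑ n ∈ Q, φ n = 0) :
    μ * ∑ n, φ n ^ 2 ≤ (2 ^ d + 1) * ∑ n, φ n * hamiltonian V φ n := by
  have hs := side_pos hμ
  have hbox : ∀ Q ∈ partition d K (side μ), ∑ n ∈ Q, μ * φ n ^ 2
      ≤ ∑ n ∈ Q, (2 ^ d * (∑ i, edgeEnergy φ i n) + φ n ^ 2 / u n) := by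
    intro Q hQ
    have hE : 0 ≤ ∑ n ∈ Q, ∑ i, edgeEnergy φ i n :=
      Finset.sum_nonneg fun n _ => Finset.sum_nonneg fun i _ => edgeEnergy_nonneg φ i n
    by_cases hex : ∃ n ∈ Q, 1 / u n ≤ μ
    · have h1 := poincare_box hs hQ φ (h0 Q hQ hex)
      have h2 : 0 ≤ ∑ n ∈ Q, φ n ^ 2 / u n :=
        Finset.sum_nonneg fun n _ => div_nonneg (sq_nonneg _) (hu n).le
      rw [Finset.sum_add_distrib, ← Finset.mul_sum, ← Finset.mul_sum]
      have h3 := mul_le_mul_of_nonneg_left h1 hμ.le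
      have h4 := mul_le_mul_of_nonneg_right (mul_side_le hμ)
        (mul_nonneg (pow_nonneg (zero_le_two (α := ℝ)) d) hE)
      linarith
    · push Not at hex
      refine Finset.sum_le_sum fun n hn => ?_
      have h1 : μ * φ n ^ 2 ≤ 1 / u n * φ n ^ 2 :=
        mul_le_mul_of_nonneg_right (hex n hn).le (sq_nonneg _)
      have h2 : 0 ≤ (2 : ℝ) ^ d * ∑ i, edgeEnergy φ i n :=
        mul_nonneg (by positivity) (Finset.sum_nonneg fun i _ => edgeEnergy_nonneg φ i n)
      rw [one_div_mul_eq_div] at h1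
      linarith
  have hsum := Finset.sum_le_sum hbox
  -- Each edge is charged to the box of its starting point, so the box energies add up exactly to
  -- the total energy.
  rw [sum_partition hs, sum_partition hs, Finset.sum_add_distrib, ← Finset.mul_sum,
    ← Finset.mul_sum] at hsum
  have h1 := mul_le_mul_of_nonneg_left (sum_edgeEnergy_le_form hV φ)
    (pow_nonneg (zero_le_two (α := ℝ)) d)
  have h2 := sum_sq_div_landscape_le_form hu hHu φ
  linarith

/-- The upper bound of the landscape law. -/
theorem ids_le_boxCount {V u : Torus d K → ℝ} (hV : ∀ n, 0 ≤ V n) (hu : ∀ n, 0 < u n)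
    (hHu : ∀ n, hamiltonian V u n = 1) {μ : ℝ} (hμ : 0 < μ) :
    ids V μ ≤ boxCount u ((2 ^ d + 2) * μ) := by
  classical
  -- One more than the loss `2 ^ d + 1`, to make the min-max inequality strict.
  have hμ' : 0 < (2 ^ d + 2) * μ := by positivity
  unfold ids boxCount
  refine div_le_div_of_nonneg_right (Nat.cast_le.mpr ?_) (by positivity)
  refine (card_roots_le_of_constraints (hamiltonian V) (hamiltonian_symmetric V)
    ((partition d K (side ((2 ^ d + 2) * μ))).filter
      fun Q => ∃ n ∈ Q, 1 / u n ≤ (2 ^ d + 2) * μ)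
    (fun Q => ∑ n ∈ Q, LinearMap.proj n) μ fun φ hφ hcon => ?_).trans_eq (by congr!)
  have h1 := le_form_of_mean_zero hV hu hHu hμ' φ fun Q hQ hex => by
    have := hcon Q (Finset.mem_filter.mpr ⟨hQ, hex⟩)
    simpa using this
  obtain ⟨m, hm⟩ := Function.ne_iff.mp hφ
  have hpos : 0 < ∑ n, φ n ^ 2 :=
    (Finset.sum_pos_iff_of_nonneg fun n _ => sq_nonneg (φ n)).mpr
      ⟨m, Finset.mem_univ m, (sq_nonneg _).lt_of_ne' (pow_ne_zero 2 hm)⟩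
  by_contra! hle
  have h2 : (2 ^ d + 1) * ∑ n, φ n * hamiltonian V φ n ≤ (2 ^ d + 1) * (μ * ∑ n, φ n ^ 2) :=
    mul_le_mul_of_nonneg_left hle (by positivity)
  nlinarith [mul_pos hμ hpos]

theorem boxCount_le_one (u : Torus d K → ℝ) {μ : ℝ} (hμ : 0 < μ) : boxCount u μ ≤ 1 := by
  have hK : (0 : ℝ) < (K : ℝ) ^ d :=
    pow_pos (Nat.cast_pos.mpr (Nat.pos_of_ne_zero (NeZero.ne K))) d
  rw [boxCount, div_le_one hK]
  exact_mod_cast (Finset.card_filter_le _ _).trans (card_partition_le (side_pos hμ))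

theorem boxCount_eq_zero {u : Torus d K → ℝ} (hu : ∀ n, 0 < u n) {M μ : ℝ} (hM : ∀ n, u n ≤ M)
    (hμ : μ * M < 1) : boxCount u μ = 0 := by
  classical
  rw [boxCount, Finset.filter_false_of_mem, Finset.card_empty, Nat.cast_zero, zero_div]
  rintro Q - ⟨n, -, hn⟩
  rw [div_le_iff₀ (hu n)] at hn
  rcases le_or_gt μ 0 with h | h
  · nlinarith [hu n]
  · nlinarith [hM n]

theorem ids_nonneg (V : Torus d K → ℝ) (μ : ℝ) : 0 ≤ ids V μ := by
  unfold ids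
  positivity

theorem ids_eq_one {V : Torus d K → ℝ} {M μ : ℝ} (hV : ∀ n, V n ≤ M) (hμ : 4 * d + M ≤ μ) :
    ids V μ = 1 := by
  have hK : (K : ℝ) ^ d ≠ 0 := pow_ne_zero d (Nat.cast_ne_zero.mpr (NeZero.ne K))
  rw [ids, card_roots_eq_of_form_le _ (hamiltonian_symmetric V) μ fun φ => (form_le hV φ).trans
    (mul_le_mul_of_nonneg_right hμ (Finset.sum_nonneg fun n _ => sq_nonneg _))]
  rw [Fintype.card_fun, ZMod.card, Fintype.card_fin, Nat.cast_pow, div_self hK]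

/-- The lower bound of the landscape law: if `u ≤ M`, boxes are counted only at energies `c μ` for
which `μ` exceeds the whole spectrum. -/
theorem boxCount_le_ids {V u : Torus d K → ℝ} (hu : ∀ n, 0 < u n) {M v c μ : ℝ}
    (hV : ∀ n, V n ≤ v) (hM : ∀ n, u n ≤ M) (hc : 0 < c) (hcM : c * M * (4 * d + v) < 1)
    (hμ : 0 < μ) : boxCount u (c * μ) ≤ ids V μ := by
  -- Either `μ` is above the whole spectrum, or `c * μ` is below `1 / M` and the box count vanishes.
  rcases le_or_gt (4 * d + v) μ with h | h
  · rw [ids_eq_one hV h]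
    exact boxCount_le_one u (mul_pos hc hμ)
  · rw [boxCount_eq_zero hu hM]
    · exact ids_nonneg V μ
    · have hM0 : 0 ≤ M := (hu 0).le.trans (hM 0)
      have : c * M * μ ≤ c * M * (4 * d + v) :=
        mul_le_mul_of_nonneg_left h.le (mul_nonneg hc.le hM0)
      linarith

end Law

end LandscapeLaw

theorem corollary1p4 (d : ℕ) :
    ∃ C₁ c₃ : ℝ, 0 < C₁ ∧ 0 < c₃ ∧
      ∀ (Vmax : ℝ) (p : Fin d → ℕ), ∃ c₂ : ℝ, 0 < c₂ ∧
        ∀ (K : ℕ) [NeZero K], 3 ≤ K → (∀ i, p i ∣ K) →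
          ∀ V : LandscapeLaw.Torus d K → ℝ,
            (∀ n, 0 ≤ V n) → (∃ m n, V m ≠ V n) → IsGreatest (Set.range V) Vmax →
            LandscapeLaw.IsPeriodic V p →
            ∀ μ : ℝ, 0 < μ →
              c₃ * LandscapeLaw.boxCount (LandscapeLaw.landscape V) (c₂ * μ)
                  ≤ LandscapeLaw.ids V μ ∧
                LandscapeLaw.ids V μ
                  ≤ LandscapeLaw.boxCount (LandscapeLaw.landscape V) (C₁ * μ) := by
  refine ⟨2 ^ d + 2, 1, by positivity, one_pos, fun v p => ?_⟩
  -- The constant is chosen before `v > 0` is known; `|v|` keeps it non-negative for every real `v`.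
  let M : ℝ := (1 + 2 * d * (2 * d + 1) ^ (∑ i, p i)) / |v| + (2 * d + 1) ^ (∑ i, p i)
  have hM0 : 0 ≤ M := by positivity
  have hB : 0 ≤ M * (4 * d + |v|) := by positivity
  -- The `+ 1` gives both positivity and the strict `c₂ * M * (4 * d + v) < 1`.
  refine ⟨(M * (4 * d + |v|) + 1)⁻¹, by positivity, fun K _ _ hp V hV hne hmax hper μ hμ => ?_⟩
  have hle : ∀ n, V n ≤ v := fun n => hmax.2 ⟨n, rfl⟩
  have hV' : ∃ n, V n ≠ 0 := by
    by_contra! h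
    obtain ⟨m, n, hmn⟩ := hne
    exact hmn (by rw [h, h])
  have hv : 0 < v := by
    obtain ⟨n, hn⟩ := hV'
    exact (lt_of_le_of_ne (hV n) hn.symm).trans_le (hle n)
  have hu := LandscapeLaw.landscape_pos hV hV'
  have hHu := LandscapeLaw.hamiltonian_landscape hV hV'
  have huM : ∀ n, LandscapeLaw.landscape V n ≤ M := by
    have := LandscapeLaw.landscape_le_of_periodic hV hu hHu hper hp hv hmax.1
    simpa only [M, abs_of_pos hv] using this
  refine ⟨?_, LandscapeLaw.ids_le_boxCount hV hu hHu hμ⟩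
  rw [one_mul]
  refine LandscapeLaw.boxCount_le_ids hu hle huM (by positivity) ?_ hμ
  rw [mul_assoc, ← abs_of_pos hv, abs_abs, inv_mul_lt_one₀ (by positivity)]
  exact lt_add_one _
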